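/- Let $d\ge 1$. For a compact set $C\subset\mathbb R^d$, let $G_1,G_2,\dots$ be its bounded gaps, i.e. the (at most countably many) bounded path-connected components of $\mathbb R^d\setminus C$, ordered by non-increasing diameter, and let $E$ be its unbounded gap, i.e. the unbounded path-connected component of $\mathbb R^d\setminus C$ (the union of the two unbounded components if $d=1$). If $C$ has at least one bounded gap, its (Falconer–Yavicoli) thickness is $$\tau(C)=\inf_{n}\frac{\operatorname{dist}\bigl(G_n,\ \bigcup_{1\le i\le n-1}G_i\cup E\bigr)}{\operatorname{diam}(G_n)},$$ where $\tau(C)$ is set to $0$ if the bounded gaps cannot be ordered in this way. If $C$ has no bounded gap, then $\tau(C)=+\infty$ if $C$ has non-empty interior and $\tau(C)=0$ otherwise. The convention $0\cdot\infty=0$ is used. For a tree $T^k$ on the vertex set $\{1,\dots,k+1\}$ (so with $k$ edges), write $i\sim j$ for its adjacency relation. For a set $B\subset\mathbb R^{2d}$ and a point $x\in\mathbb R^{2d}$, the tree distance set pinned at $x$ is $$\Delta_{T_x^k}(B)=\Bigl\{\bigl(|x^i-x^j|\bigr)_{i\sim j}\ :\ x^1,\dots,x^{k+1}\in B \text{ pairwise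 distinct},\ x=x^i\text{ for some } i\Bigr\}\subset\mathbb R^k,$$ where the coordinates of $\mathbb R^k$ are indexed by the edges of $T^k$ and $|\cdot|$ is the Euclidean norm on $\mathbb R^{2d}$. **Theorem.** Let $C_1,C_2\subset\mathbb R^d$ be compact sets with $\tau(C_1)\tau(C_2)>1$. Then for every point $x\in C_1\times C_2\subset\mathbb R^{2d}$, every integer $k\ge 0$ and every tree $T^k$ with $k+1$ vertices, the set $\Delta_{T_x^k}(C_1\times C_2)$ has non-empty interior in $\mathbb R^k$. -/

import Mathlib

open scoped ENNReal

noncomputable section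

/-- The bounded gaps of `C`: the bounded path components of the complement of `C`. -/
def boundedGaps {d : ℕ} (C : Set (EuclideanSpace ℝ (Fin d))) :
    Set (Set (EuclideanSpace ℝ (Fin d))) :=
  {G | ∃ x ∈ Cᶜ, G = pathComponentIn Cᶜ x ∧ Bornology.IsBounded G}

/-- The unbounded gap `E` of `C`: the union of the unbounded path components of the complement
of `C` (for compact `C` a single component if `2 ≤ d`, and two half-lines if `d = 1`). -/
def unboundedGap {d : ℕ} (C : Set (EuclideanSpace ℝ (Fin d))) :
    Set (EuclideanSpace ℝ (Fin d)) :=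
  {x | x ∈ Cᶜ ∧ ¬ Bornology.IsBounded (pathComponentIn Cᶜ x)}

/-- The distance `inf {|a - b| : a ∈ A, b ∈ B}` between two sets. -/
def setEDist {X : Type*} [PseudoEMetricSpace X] (A B : Set X) : ℝ≥0∞ :=
  ⨅ a ∈ A, ⨅ b ∈ B, edist a b

/-- A (finite or infinite) enumeration `G₀, G₁, …` without repetition of all bounded gaps of `C`,
ordered by non-increasing diameter; `count` is the number of gaps. -/
structure GapEnumeration {d : ℕ} (C : Set (EuclideanSpace ℝ (Fin d))) where
  count : ℕ∞
  gap : {n : ℕ // (n : ℕ∞) < count} ≃ boundedGaps C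
  antitone_diam : Antitone fun n => Metric.ediam (gap n : Set (EuclideanSpace ℝ (Fin d)))

/-- `inf_n dist(G_n, ⋃_{i < n} G_i ∪ E) / diam(G_n)` for an enumeration of the bounded gaps. -/
def GapEnumeration.thickness {d : ℕ} {C : Set (EuclideanSpace ℝ (Fin d))}
    (e : GapEnumeration C) : ℝ≥0∞ :=
  ⨅ n, setEDist (e.gap n : Set (EuclideanSpace ℝ (Fin d)))
      ((⋃ i, ⋃ (_ : i < n), (e.gap i : Set (EuclideanSpace ℝ (Fin d)))) ∪ unboundedGap C) /
    Metric.ediam (e.gap n : Set (EuclideanSpace ℝ (Fin d)))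

open Classical in
/-- The Falconer–Yavicoli thickness of a compact set `C ⊆ ℝ^d`.

If there are bounded gaps, `e.thickness` does not depend on the enumeration `e` of them by
non-increasing diameter (ties may be broken in any way), so the supremum is the common value.
If the gaps cannot be so enumerated, then infinitely many of them have diameters bounded below,
their mutual distances have infimum `0`, and the value is set to `0`. -/
def thickness {d : ℕ} (C : Set (EuclideanSpace ℝ (Fin d))) : ℝ≥0∞ :=
  if (boundedGaps C).Nonempty then ⨆ e : GapEnumeration C, e.thickness
  else if (interior C).Nonempty then ⊤ else 0

/-- The product `C₁ × C₂` as a subset of `ℝ^d × ℝ^d = ℝ^{2d}` with its Euclidean metric. -/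
def euclideanProd {d : ℕ} (C₁ C₂ : Set (EuclideanSpace ℝ (Fin d))) :
    Set (WithLp 2 (EuclideanSpace ℝ (Fin d) × EuclideanSpace ℝ (Fin d))) :=
  {p | p.fst ∈ C₁ ∧ p.snd ∈ C₂}

/-- The length `|p i - p j|` of the edge `{i, j}` in a placement `p` of the vertices. -/
def edgeLength {V X : Type*} [PseudoMetricSpace X] (p : V → X) : Sym2 V → ℝ :=
  Sym2.lift ⟨fun i j => dist (p i) (p j), fun i j => dist_comm (p i) (p j)⟩

/-- The pinned distance set of a graph `T`: the vectors of edge lengths, indexed by the edges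
of `T`, of all placements of the vertices of `T` at distinct points of `B` for which some vertex
lies at the pin `x`. -/
def pinnedDistanceSet {V X : Type*} [PseudoMetricSpace X] (T : SimpleGraph V) (x : X)
    (B : Set X) : Set (T.edgeSet → ℝ) :=
  {v | ∃ p : V → X, (∀ i, p i ∈ B) ∧ Function.Injective p ∧ (∃ i, p i = x) ∧
    v = fun e : T.edgeSet => edgeLength p (e : Sym2 V)}

end

open scoped ENNReal

/-! Take a pin `y = (y₁, y₂)` and a bounded gap of each factor. A line through `y₁` that meets the
first gap leaves it for the last time at some parameter `R₁ > 0`; define `R₂` likewise. Traces of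
gaps on these lines still satisfy the thickness inequality. In the plane of the two lines, a circle
about the pin of radius slightly beyond the corner `(R₁, R₂)` has an arc with one end over the first
gap and the other over the second, while no point of it lies over both. If the arc missed `C₁ × C₂`,
traces of gaps would cover it. Near the corner its two coordinates control each other with Lipschitz
constants whose product is close to 1, hence below `τ₁ * τ₂`, and a Newhouse-type gap lemma forbids
such a cover (`GapSystem.exists_forall_notMem`, `GapSystem.exists_sq_add_sq_eq`).

All this survives a small motion of the pin: one interval of distances serves all pins near `y`,
attained near one point `p` (`LocalGapSystem.exists_pinned_interval`). Trees are then built by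
attaching leaves (`exists_edgeLength_box_of_isTree`), the stability absorbing the motion of the
leaf's neighbour. Vertices stay distinct because the gap can be chosen away from any finite set:
with infinitely many gaps some later one will do, and otherwise `C` has interior, where a small ball
can play the role of a gap. -/

/-- A sequence of pairwise disjoint open sets such that the distance from each of them to the
earlier ones is at least `τ` times its diameter. -/
structure GapSystem {X : Type*} [PseudoMetricSpace X] (τ : ℝ) (G : ℕ → Set X) : Prop where
  isOpen : ∀ n, IsOpen (G n)
  eq_of_mem : ∀ m n u, u ∈ G m → u ∈ G n → m = n
  sep : ∀ m n, m < n → ∀ u ∈ G m, ∀ v ∈ G n, ∀ w ∈ G n, τ * dist v w ≤ dist v u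

/-! ### Combinatorics of the overlap graph -/

open Classical in
/-- The least neighbour of a vertex of the bipartite graph on `ℕ ⊕ ℕ` with edge relation `R`
(and the vertex itself if it is isolated). -/
noncomputable def leastNeighbour (R : ℕ → ℕ → Prop) : ℕ ⊕ ℕ → ℕ ⊕ ℕ
  | .inl i => if h : ∃ j, R i j then .inr (Nat.find h) else .inl i
  | .inr j => if h : ∃ i, R i j then .inl (Nat.find h) else .inr j

theorem leastNeighbour_inl {R : ℕ → ℕ → Prop} {i j : ℕ} (h : R i j) (hj : ∀ j' < j, ¬ R i j') :
    leastNeighbour R (.inl i) = .inr j := by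
  have h' : ∃ j, R i j := ⟨j, h⟩
  classical
  simp only [leastNeighbour, h', dif_pos, Sum.inr.injEq]
  exact (Nat.find_eq_iff _).2 ⟨h, fun n hn => hj n hn⟩

theorem leastNeighbour_inr {R : ℕ → ℕ → Prop} {i j : ℕ} (h : R i j) (hi : ∀ i' < i, ¬ R i' j) :
    leastNeighbour R (.inr j) = .inl i := by
  have h' : ∃ i, R i j := ⟨i, h⟩
  classical
  simp only [leastNeighbour, h', dif_pos, Sum.inl.injEq]
  exact (Nat.find_eq_iff _).2 ⟨h, fun n hn => hi n hn⟩

/-- No index is below 0, so 0 is the least neighbour of each of its neighbours. Its orbit thus has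
at most two elements. -/
theorem leastNeighbour_leastNeighbour_inl_zero (R : ℕ → ℕ → Prop) :
    leastNeighbour R (leastNeighbour R (.inl 0)) = .inl 0 := by
  classical
  by_cases h : ∃ j, R 0 j
  · rw [leastNeighbour_inl (Nat.find_spec h) fun _ => Nat.find_min h]
    exact leastNeighbour_inr (Nat.find_spec h) (by simp)
  · have : leastNeighbour R (.inl 0) = .inl 0 := by simp only [leastNeighbour, h, dif_neg,
      not_false_eq_true]
    rw [this, this]

theorem leastNeighbour_leastNeighbour_inr_zero (R : ℕ → ℕ → Prop) :
    leastNeighbour R (leastNeighbour R (.inr 0)) = .inr 0 := by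
  classical
  by_cases h : ∃ i, R i 0
  · rw [leastNeighbour_inr (Nat.find_spec h) fun _ => Nat.find_min h]
    exact leastNeighbour_inl (Nat.find_spec h) (by simp)
  · have : leastNeighbour R (.inr 0) = .inr 0 := by simp only [leastNeighbour, h, dif_neg,
      not_false_eq_true]
    rw [this, this]

/-- If one end of each edge of a bipartite graph on `ℕ ⊕ ℕ` is the least neighbour of the other
end, then the two vertices `0` are adjacent or in different components. -/
theorem exists_separation (R : ℕ → ℕ → Prop)
    (hR : ∀ i j, R i j → (∀ i' < i, ¬ R i' j) ∨ (∀ j' < j, ¬ R i j')) (h00 : ¬ R 0 0) :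
    ∃ S₁ S₂ : Set ℕ, 0 ∉ S₁ ∧ 0 ∈ S₂ ∧ ∀ i j, R i j → (i ∈ S₁ ↔ j ∈ S₂) := by
  classical
  set f := leastNeighbour R with hf
  -- Each edge joins some vertex to its image under `f`, so a set with `v ∈ S ↔ f v ∈ S` is a union
  -- of components.
  let S : Set (ℕ ⊕ ℕ) := {v | ∃ n, f^[n] v = .inr 0}
  have hS : ∀ v, v ∈ S ↔ f v ∈ S := by
    refine fun v => ⟨?_, fun ⟨n, hn⟩ => ⟨n + 1, hn⟩⟩
    rintro ⟨_ | n, hn⟩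
    · obtain rfl : v = .inr 0 := hn
      exact ⟨1, leastNeighbour_leastNeighbour_inr_zero R⟩
    · exact ⟨n, hn⟩
  refine ⟨Sum.inl ⁻¹' S, Sum.inr ⁻¹' S, ?_, ⟨0, rfl⟩, fun i j hij => ?_⟩
  · rintro ⟨n, hn⟩
    have key : ∀ n, f^[n] (.inl 0) = .inl 0 ∨ f^[n] (.inl 0) = f (.inl 0) := by
      intro n
      induction n with
      | zero => exact .inl rfl
      | succ n ih =>
        rw [Function.iterate_succ_apply']
        rcases ih with h | h
        · exact .inr (by rw [h])
        · exact .inl (by rw [h]; exact leastNeighbour_leastNeighbour_inl_zero R)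
    rcases key n with h | h
    · simp [h] at hn
    · rw [h, hf] at hn
      by_cases h' : ∃ j, R 0 j
      · rw [leastNeighbour_inl (Nat.find_spec h') fun _ => Nat.find_min h'] at hn
        have := Nat.find_spec h'
        rw [Sum.inr.inj hn] at this
        exact h00 this
      · simp [leastNeighbour, h'] at hn
  · change Sum.inl i ∈ S ↔ Sum.inr j ∈ S
    rcases hR i j hij with h | h
    · rw [hS (.inr j), hf, leastNeighbour_inr hij h]
    · rw [hS (.inl i), hf, leastNeighbour_inl hij h]

/-! ### The gap lemma along curves -/

/-- A gap lemma along a pair of curves. -/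
theorem GapSystem.exists_forall_notMem {X Y : Type*} [MetricSpace X] [MetricSpace Y]
    {τ₁ τ₂ a b : ℝ} {G : ℕ → Set X} {U : ℕ → Set Y} (hG : GapSystem τ₁ G) (hU : GapSystem τ₂ U)
    (hτ₂ : 0 < τ₂) (ha : 0 ≤ a) (hab : a * b < τ₁ * τ₂)
    {I : Set ℝ} (hI : IsPreconnected I) {u : ℝ → X} {v : ℝ → Y}
    (hu : ContinuousOn u I) (hv : ContinuousOn v I)
    (huv : ∀ p ∈ I, ∀ q ∈ I, dist (u p) (u q) ≤ a * dist (v p) (v q))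
    (hvu : ∀ p ∈ I, ∀ q ∈ I, dist (v p) (v q) ≤ b * dist (u p) (u q))
    (h00 : ∀ p ∈ I, u p ∈ G 0 → v p ∉ U 0)
    (hG0 : ∃ p ∈ I, u p ∈ G 0) (hU0 : ∃ p ∈ I, v p ∈ U 0) :
    ∃ p ∈ I, (∀ n, u p ∉ G n) ∧ ∀ n, v p ∉ U n := by
  by_contra! hcov
  let R : ℕ → ℕ → Prop := fun i j => ∃ p ∈ I, u p ∈ G i ∧ v p ∈ U j
  obtain ⟨S₁, S₂, h₁, h₂, hS⟩ := exists_separation R (by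
    rintro i j ⟨p, hp, hpi, hpj⟩
    by_contra! hcon
    obtain ⟨⟨i', hi', p', hp', hpi', hpj'⟩, ⟨j', hj', q, hq, hqi, hqj⟩⟩ := hcon
    -- Gap `i` separates `u p` from the earlier gap `i'`, and gap `j` separates `v p` from `j'`.
    -- Chaining both estimates through the Lipschitz bounds gives `τ₁ * τ₂ ≤ a * b`.
    have e1 := (hG.sep i' i hi' _ hpi' _ hpi _ hqi).trans (huv p hp p' hp')
    have e2 := (hU.sep j' j hj' _ hqj _ hpj _ hpj').trans (hvu p hp q hq)
    have e3 : 0 < dist (u p) (u q) := by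
      refine lt_of_le_of_ne dist_nonneg fun h0 => ?_
      have := hvu p hp q hq
      rw [← h0, mul_zero] at this
      rw [dist_le_zero.1 this] at hpj
      exact hj'.ne (hU.eq_of_mem _ _ _ hqj hpj)
    have e4 : τ₁ * τ₂ * dist (u p) (u q) ≤ a * b * dist (u p) (u q) := by
      calc _ = τ₂ * (τ₁ * dist (u p) (u q)) := by ring
        _ ≤ τ₂ * (a * dist (v p) (v p')) := by gcongr
        _ = a * (τ₂ * dist (v p) (v p')) := by ring
        _ ≤ a * (b * dist (u p) (u q)) := by gcongr
        _ = _ := by ring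
    exact absurd (le_of_mul_le_mul_right e4 e3) (not_le.2 hab))
    (by rintro ⟨p, hp, h, h'⟩; exact h00 p hp h h')
  -- The two sides of the separation give two open sets covering `I`, both non-empty. A common point
  -- would yield an edge across the separation, or one point in two gaps of the same system.
  let A (T₁ T₂ : Set ℕ) : Set (I : Set ℝ) :=
    {p | (∃ n ∈ T₁, u p ∈ G n) ∨ ∃ n ∈ T₂, v p ∈ U n}
  have hA : ∀ T₁ T₂, IsOpen (A T₁ T₂) := by
    intro T₁ T₂
    have : A T₁ T₂ = (I.domRestrict u) ⁻¹' (⋃ n ∈ T₁, G n) ∪ (I.domRestrict v) ⁻¹' (⋃ n ∈ T₂, U n) := by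
      ext p; simp [A, Set.domRestrict]
    rw [this]
    exact ((isOpen_biUnion fun n _ => hG.isOpen n).preimage hu.domRestrict).union
      ((isOpen_biUnion fun n _ => hU.isOpen n).preimage hv.domRestrict)
  have := isPreconnected_iff_preconnectedSpace.1 hI
  obtain ⟨p, hp, hpG⟩ := hG0
  obtain ⟨q, hq, hqU⟩ := hU0
  obtain ⟨⟨r, hr⟩, -, hr1, hr2⟩ := (isPreconnected_univ (α := I)) (A S₁ S₂) (A S₁ᶜ S₂ᶜ) (hA _ _)
    (hA _ _) (by
      rintro ⟨r, hr⟩ -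
      by_cases h : ∃ n, u r ∈ G n
      · obtain ⟨n, hn⟩ := h
        by_cases hnS : n ∈ S₁
        exacts [.inl (.inl ⟨n, hnS, hn⟩), .inr (.inl ⟨n, hnS, hn⟩)]
      · obtain ⟨n, hn⟩ := hcov r hr (not_exists.1 h)
        by_cases hnS : n ∈ S₂
        exacts [.inl (.inr ⟨n, hnS, hn⟩), .inr (.inr ⟨n, hnS, hn⟩)])
    ⟨⟨q, hq⟩, trivial, .inr ⟨0, h₂, hqU⟩⟩ ⟨⟨p, hp⟩, trivial, .inl ⟨0, h₁, hpG⟩⟩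
  rcases hr1 with ⟨m, hm, hrm⟩ | ⟨m, hm, hrm⟩ <;> rcases hr2 with ⟨n, hn, hrn⟩ | ⟨n, hn, hrn⟩
  · exact hn (hG.eq_of_mem _ _ _ hrm hrn ▸ hm)
  · exact hn ((hS m n ⟨r, hr, hrm, hrn⟩).1 hm)
  · exact hn ((hS n m ⟨r, hr, hrn, hrm⟩).2 hm)
  · exact hn (hU.eq_of_mem _ _ _ hrm hrn ▸ hm)

/-! ### Circles in the plane -/

theorem abs_sub_le_of_sq_add_sq_eq {p q p' q' l h : ℝ} (e : p ^ 2 + q ^ 2 = p' ^ 2 + q' ^ 2)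
    (hl : 0 < l) (hp : l ≤ p) (hp' : l ≤ p') (hq : 0 ≤ q) (hq' : 0 ≤ q') (hqh : q ≤ h)
    (hqh' : q' ≤ h) : |p - p'| ≤ h / l * |q - q'| := by
  have e1 : |p - p'| * (p + p') = |q - q'| * (q + q') := by
    rw [← abs_of_nonneg (by linarith : 0 ≤ p + p'), ← abs_of_nonneg (by linarith : 0 ≤ q + q'),
      ← abs_mul, ← abs_mul, ← abs_neg]
    congr 1
    linarith
  rw [div_mul_eq_mul_div, le_div_iff₀ hl]
  have h1 : |p - p'| * (2 * l) ≤ |p - p'| * (p + p') :=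
    mul_le_mul_of_nonneg_left (by linarith) (abs_nonneg _)
  have h2 : |q - q'| * (q + q') ≤ |q - q'| * (2 * h) :=
    mul_le_mul_of_nonneg_left (by linarith) (abs_nonneg _)
  linarith

open Filter Topology in
/-- Near the right end of the first gaps of two gap systems on the line, all circles with
approximately the given centre and radius meet the product of the complements of the gaps. -/
theorem GapSystem.exists_sq_add_sq_eq {τ₁ τ₂ R₁ R₂ δ η : ℝ} {A₁ A₂ : Set ℝ} {G U : ℕ → Set ℝ}
    (hG : GapSystem τ₁ G) (hU : GapSystem τ₂ U) (hτ₂ : 0 < τ₂) (hτ : 1 < τ₁ * τ₂)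
    (hR₁ : 0 < R₁) (hR₂ : 0 < R₂) (hGR : ∀ r ∈ G 0, r ≤ R₁) (hUR : ∀ r ∈ U 0, r ≤ R₂)
    (hRG : R₁ ∈ closure (G 0)) (hRU : R₂ ∈ closure (U 0)) (hδ : 0 < δ)
    (hA₁ : ∀ r, |r - R₁| < δ → r ∈ A₁ ∨ ∃ n, r ∈ G n)
    (hA₂ : ∀ r, |r - R₂| < δ → r ∈ A₂ ∨ ∃ n, r ∈ U n) (hη : 0 < η) :
    ∃ ρ > 0, ∃ α β, 0 ≤ α ∧ α < β ∧ ∀ s₁ s₂ T, |s₁| < ρ → |s₂| < ρ → α < T → T < β →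
      ∃ r₁ ∈ A₁, ∃ r₂ ∈ A₂, |r₁ - R₁| < η ∧ |r₂ - R₂| < η ∧
        (r₁ + s₁) ^ 2 + (r₂ + s₂) ^ 2 = T := by
  -- At `ε = 0` the last inequality is `R₂ * R₁ < τ₁ * τ₂ * (R₁ * R₂)`. The margin `2 * ε` allows
  -- `ε` for the extent of the arc and `ε` for the shift of the centre.
  obtain ⟨ε, hε0, hεη, hεδ, hε1, hε2, hετ⟩ : ∃ ε : ℝ, 0 < ε ∧ ε < η ∧ ε < δ ∧ 3 * ε < R₁ ∧
      3 * ε < R₂ ∧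
      (R₂ + 2 * ε) * (R₁ + 2 * ε) < τ₁ * τ₂ * ((R₁ - 2 * ε) * (R₂ - 2 * ε)) := by
    have h : ∀ᶠ ε in 𝓝 (0 : ℝ), ε < η ∧ ε < δ ∧ 3 * ε < R₁ ∧ 3 * ε < R₂ ∧
        (R₂ + 2 * ε) * (R₁ + 2 * ε) < τ₁ * τ₂ * ((R₁ - 2 * ε) * (R₂ - 2 * ε)) := by
      refine (eventually_lt_nhds hη).and ((eventually_lt_nhds hδ).and ?_)
      refine (Tendsto.eventually_lt_const (v := 0) (by simpa) ?_).and
        ((Tendsto.eventually_lt_const (v := 0) (by simpa) ?_).and ?_)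
      · exact Continuous.tendsto' (by fun_prop) _ _ (by simp)
      · exact Continuous.tendsto' (by fun_prop) _ _ (by simp)
      · refine Tendsto.eventually_lt (y := R₂ * R₁) (z := τ₁ * τ₂ * (R₁ * R₂))
          (Continuous.tendsto' (by fun_prop) _ _ (by simp))
          (Continuous.tendsto' (by fun_prop) _ _ (by simp)) ?_
        nlinarith [mul_pos hR₁ hR₂]
    obtain ⟨ε, hε, hε0⟩ := ((h.filter_mono nhdsWithin_le_nhds).and
      (self_mem_nhdsWithin : Set.Ioi (0 : ℝ) ∈ 𝓝[>] 0)).exists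
    exact ⟨ε, hε0, hε⟩
  -- The point `g₁` is so close to `R₁` that circles slightly beyond the corner are still below
  -- height `R₂ + ε` over `g₁`.
  obtain ⟨g₁, hg₁, hg₁ε, hg₁R⟩ : ∃ g ∈ G 0, R₁ - ε < g ∧
      R₁ ^ 2 + R₂ ^ 2 < g ^ 2 + (R₂ + ε) ^ 2 := by
    have h : ∀ᶠ g in 𝓝 R₁, R₁ - ε < g ∧ R₁ ^ 2 + R₂ ^ 2 < g ^ 2 + (R₂ + ε) ^ 2 :=
      (eventually_gt_nhds (by linarith)).and <| Tendsto.eventually_const_lt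
        (v := R₁ ^ 2 + (R₂ + ε) ^ 2) (by nlinarith) (Continuous.tendsto' (by fun_prop) _ _ rfl)
    obtain ⟨g, hg, hg'⟩ := ((mem_closure_iff_frequently.1 hRG).and_eventually h).exists
    exact ⟨g, hg, hg'⟩
  obtain ⟨g₂, hg₂, hg₂ε, hg₂R⟩ : ∃ g ∈ U 0, R₂ - ε < g ∧
      R₁ ^ 2 + R₂ ^ 2 < (R₁ + ε) ^ 2 + g ^ 2 := by
    have h : ∀ᶠ g in 𝓝 R₂, R₂ - ε < g ∧ R₁ ^ 2 + R₂ ^ 2 < (R₁ + ε) ^ 2 + g ^ 2 :=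
      (eventually_gt_nhds (by linarith)).and <| Tendsto.eventually_const_lt
        (v := (R₁ + ε) ^ 2 + R₂ ^ 2) (by nlinarith) (Continuous.tendsto' (by fun_prop) _ _ rfl)
    obtain ⟨g, hg, hg'⟩ := ((mem_closure_iff_frequently.1 hRU).and_eventually h).exists
    exact ⟨g, hg, hg'⟩
  obtain ⟨α, hα, hα'⟩ := exists_between (lt_min hg₁R hg₂R)
  obtain ⟨β, hαβ, hβ⟩ := exists_between hα'
  rw [lt_min_iff] at hβ
  obtain ⟨ρ, hρ, hρ'⟩ : ∃ ρ > 0, ∀ s₁ s₂ : ℝ, |s₁| < ρ → |s₂| < ρ → |s₁| < ε ∧ |s₂| < ε ∧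
      (R₁ + s₁) ^ 2 + (R₂ + s₂) ^ 2 < α ∧ β < (g₁ + s₁) ^ 2 + (R₂ + ε + s₂) ^ 2 ∧
      β < (R₁ + ε + s₁) ^ 2 + (g₂ + s₂) ^ 2 := by
    have h : ∀ᶠ s in 𝓝 (0 : ℝ × ℝ), (R₁ + s.1) ^ 2 + (R₂ + s.2) ^ 2 < α ∧
        β < (g₁ + s.1) ^ 2 + (R₂ + ε + s.2) ^ 2 ∧ β < (R₁ + ε + s.1) ^ 2 + (g₂ + s.2) ^ 2 := by
      refine (Tendsto.eventually_lt_const hα ?_).and ((Tendsto.eventually_const_lt hβ.1 ?_).and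
        (Tendsto.eventually_const_lt hβ.2 ?_)) <;>
      exact Continuous.tendsto' (by fun_prop) _ _ (by simp)
    obtain ⟨ρ, hρ, h⟩ := Metric.eventually_nhds_iff.1 h
    refine ⟨min ρ ε, lt_min hρ hε0, fun s₁ s₂ h₁ h₂ => ?_⟩
    rw [lt_min_iff] at h₁ h₂
    exact ⟨h₁.2, h₂.2, @h (s₁, s₂) (by simp [h₁.1, h₂.1])⟩
  refine ⟨ρ, hρ, α, β, (by positivity : 0 ≤ R₁ ^ 2 + R₂ ^ 2).trans hα.le, hαβ,
    fun s₁ s₂ T hs₁ hs₂ hT hT' => ?_⟩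
  obtain ⟨hs₁, hs₂, h1, h2, h3⟩ := hρ' s₁ s₂ hs₁ hs₂
  rw [abs_lt] at hs₁ hs₂
  have hg₁R := hGR _ hg₁
  have hg₂R := hUR _ hg₂
  have hu0 : 0 < g₁ + s₁ := by linarith
  have hv0 : 0 < g₂ + s₂ := by linarith
  have hT1 : (g₁ + s₁) ^ 2 + (g₂ + s₂) ^ 2 ≤ T := by
    have : (g₁ + s₁) ^ 2 ≤ (R₁ + s₁) ^ 2 := by gcongr
    have : (g₂ + s₂) ^ 2 ≤ (R₂ + s₂) ^ 2 := by gcongr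
    linarith
  have key : ∀ p ∈ Set.Icc (g₁ + s₁) √(T - (g₂ + s₂) ^ 2), g₁ + s₁ ≤ p ∧ p < R₁ + ε + s₁ ∧
      g₂ + s₂ ≤ √(T - p ^ 2) ∧ √(T - p ^ 2) < R₂ + ε + s₂ ∧ p ^ 2 + √(T - p ^ 2) ^ 2 = T := by
    rintro p ⟨hp, hp'⟩
    have hp0 : 0 ≤ p := by linarith
    rw [Real.le_sqrt' (by linarith)] at hp'
    have hpsq : (g₁ + s₁) ^ 2 ≤ p ^ 2 := by gcongr
    have hv0sq : 0 < (g₂ + s₂) ^ 2 := by positivity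
    refine ⟨hp, ?_, ?_, ?_, ?_⟩
    · exact lt_of_pow_lt_pow_left₀ 2 (by linarith) (by linarith)
    · rw [Real.le_sqrt' hv0]; linarith
    · rw [Real.sqrt_lt' (by linarith)]; linarith
    · rw [Real.sq_sqrt (by linarith)]; ring
  -- The arc is parametrised by its abscissa. Its ends lie over `g₁ ∈ G 0` and `g₂ ∈ U 0`; as `T`
  -- exceeds the squared radius of the shifted corner, no point lies over both gaps.
  obtain ⟨p, hp, hpG, hpU⟩ := hG.exists_forall_notMem hU hτ₂
    (a := (R₂ + 2 * ε) / (R₁ - 2 * ε)) (b := (R₁ + 2 * ε) / (R₂ - 2 * ε))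
    (div_nonneg (by linarith) (by linarith))
    (by
      rw [div_mul_div_comm, div_lt_iff₀ (mul_pos (by linarith) (by linarith))]
      exact hετ)
    (isPreconnected_Icc (a := g₁ + s₁) (b := √(T - (g₂ + s₂) ^ 2)))
    (u := fun p => p - s₁) (v := fun p => √(T - p ^ 2) - s₂)
    (by fun_prop) (by fun_prop)
    (fun p hp q hq => by
      obtain ⟨p1, p2, p3, p4, p5⟩ := key p hp
      obtain ⟨q1, q2, q3, q4, q5⟩ := key q hq
      simp only [Real.dist_eq, sub_sub_sub_cancel_right]
      apply abs_sub_le_of_sq_add_sq_eq (p5.trans q5.symm) <;> linarith)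
    (fun p hp q hq => by
      obtain ⟨p1, p2, p3, p4, p5⟩ := key p hp
      obtain ⟨q1, q2, q3, q4, q5⟩ := key q hq
      simp only [Real.dist_eq, sub_sub_sub_cancel_right]
      apply abs_sub_le_of_sq_add_sq_eq (by linarith) <;> linarith)
    (fun p hp hpG hpU => by
      obtain ⟨p1, p2, p3, p4, p5⟩ := key p hp
      have h4 := hGR _ hpG
      have h5 := hUR _ hpU
      have : p ^ 2 ≤ (R₁ + s₁) ^ 2 := by gcongr <;> linarith
      have : √(T - p ^ 2) ^ 2 ≤ (R₂ + s₂) ^ 2 := by gcongr; linarith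
      linarith)
    ⟨g₁ + s₁, ⟨le_rfl, Real.le_sqrt_of_sq_le (by linarith)⟩, by simpa⟩
    ⟨√(T - (g₂ + s₂) ^ 2), ⟨Real.le_sqrt_of_sq_le (by linarith), le_rfl⟩, by
      have : 0 ≤ (g₁ + s₁) ^ 2 := by positivity
      rw [Real.sq_sqrt (by linarith), sub_sub_cancel, Real.sqrt_sq hv0.le]
      simpa⟩
  obtain ⟨p1, p2, p3, p4, p5⟩ := key p hp
  have hw₁ : |p - s₁ - R₁| < ε := by rw [abs_lt]; constructor <;> linarith
  have hw₂ : |√(T - p ^ 2) - s₂ - R₂| < ε := by rw [abs_lt]; constructor <;> linarith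
  refine ⟨p - s₁, (hA₁ _ (hw₁.trans hεδ)).resolve_right (not_exists.2 hpG), √(T - p ^ 2) - s₂,
    (hA₂ _ (hw₂.trans hεδ)).resolve_right (not_exists.2 hpU), hw₁.trans hεη, hw₂.trans hεη, ?_⟩
  rw [sub_add_cancel, sub_add_cancel, p5]

/-- A gap system whose first gap is bounded and non-empty, and which near its first gap contains
all points outside `C`. -/
structure LocalGapSystem {X : Type*} [PseudoMetricSpace X] (C : Set X) (τ δ : ℝ) (G : ℕ → Set X) :
    Prop extends GapSystem τ G where
  pos : 0 < δ
  nonempty : (G 0).Nonempty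
  isBounded : Bornology.IsBounded (G 0)
  mem_or_mem : ∀ u, ∀ g ∈ G 0, dist u g < δ → u ∈ C ∨ ∃ n, u ∈ G n

/-! ### Reduction to lines through the pin -/

section Line

variable {E : Type*} [NormedAddCommGroup E] [InnerProductSpace ℝ E]

theorem dist_add_smul_add_smul {x e : E} (he : ‖e‖ = 1) (r s : ℝ) :
    dist (x + r • e) (x + s • e) = |r - s| := by
  rw [dist_add_left, dist_eq_norm, ← sub_smul, norm_smul, he, mul_one, Real.norm_eq_abs]

/-- Pythagoras: moving the pin from `x` to `y` only shifts the centre along the line and changes the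
squared radius by a constant. -/
theorem dist_add_smul_sq {x y e : E} (he : ‖e‖ = 1) (r : ℝ) :
    dist y (x + r • e) ^ 2 =
      (r + inner ℝ (x - y) e) ^ 2 + (dist x y ^ 2 - inner ℝ (x - y) e ^ 2) := by
  rw [dist_comm, dist_eq_norm, dist_eq_norm, add_sub_right_comm, norm_add_sq_real, norm_smul, he,
    inner_smul_right, mul_one, Real.norm_eq_abs, sq_abs]
  ring

theorem abs_inner_sub_le_dist {x y e : E} (he : ‖e‖ = 1) : |inner ℝ (x - y) e| ≤ dist x y := by
  simpa [he, dist_eq_norm] using abs_real_inner_le_norm (x - y) e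

/-- Every point lies on a line such that the traces on it of the gaps of a local gap system form
a gap system on the line. -/
theorem LocalGapSystem.exists_line [Nontrivial E] {C : Set E} {τ δ : ℝ} {G : ℕ → Set E}
    (hG : LocalGapSystem C τ δ G) (x : E) :
    ∃ (e : E) (R : ℝ), ‖e‖ = 1 ∧ 0 < R ∧ x + R • e ∈ closure (G 0) ∧
      GapSystem τ (fun n => {r : ℝ | x + r • e ∈ G n}) ∧ (∀ r, x + r • e ∈ G 0 → r ≤ R) ∧
      R ∈ closure {r : ℝ | x + r • e ∈ G 0} ∧
      ∀ r, |r - R| < δ / 2 → x + r • e ∈ C ∨ ∃ n, x + r • e ∈ G n := by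
  obtain ⟨g, hg, hgx⟩ : ∃ g ∈ G 0, g ≠ x := by
    by_contra! h
    have hs : G 0 = {x} := Set.eq_singleton_iff_nonempty_unique_mem.2 ⟨hG.nonempty, h⟩
    exact not_isOpen_singleton x (hs ▸ hG.isOpen 0)
  have hn : 0 < ‖g - x‖ := norm_pos_iff.2 (sub_ne_zero.2 hgx)
  set e : E := ‖g - x‖⁻¹ • (g - x) with he_def
  have he : ‖e‖ = 1 := by
    rw [he_def, norm_smul, norm_inv, norm_norm, inv_mul_cancel₀ hn.ne']
  have hge : x + ‖g - x‖ • e = g := by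
    rw [he_def, smul_inv_smul₀ hn.ne', add_sub_cancel]
  have hcont : Continuous fun r : ℝ => x + r • e := by fun_prop
  set S : Set ℝ := {r | x + r • e ∈ G 0} with hS
  have hgS : ‖g - x‖ ∈ S := by rw [hS, Set.mem_ofPred_eq, hge]; exact hg
  have hSb : BddAbove S := by
    obtain ⟨K, hK⟩ := hG.isBounded.subset_closedBall x
    refine ⟨K, fun r hr => ?_⟩
    have := hK hr
    rw [Metric.mem_closedBall, dist_comm, dist_self_add_right, norm_smul, he, mul_one,
      Real.norm_eq_abs] at this
    exact (le_abs_self r).trans this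
  have hRS : sSup S ∈ closure S := csSup_mem_closure ⟨_, hgS⟩ hSb
  refine ⟨e, sSup S, he, hn.trans_le (le_csSup hSb hgS), ?_, ?_, fun r hr => le_csSup hSb hr, hRS,
    fun r hr => ?_⟩
  · exact map_mem_closure (f := fun r : ℝ => x + r • e) hcont hRS fun r hr => hr
  · refine ⟨fun n => (hG.isOpen n).preimage hcont, fun m n r hm hn => hG.eq_of_mem m n _ hm hn,
      fun m n hmn r hr s hs t ht => ?_⟩
    have := hG.sep m n hmn _ hr _ hs _ ht
    rwa [dist_add_smul_add_smul he, dist_add_smul_add_smul he] at this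
  · obtain ⟨s, hs, hsd⟩ := Metric.mem_closure_iff.1 hRS (δ / 2) (half_pos hG.pos)
    refine hG.mem_or_mem _ _ hs ?_
    rw [dist_add_smul_add_smul he]
    rw [Real.dist_eq] at hsd
    linarith [abs_sub_le r (sSup S) s]

/-- The pinned distance sets of a product with respect to all pins close to `x` contain a common
interval, and its distances are attained close to a point `p`. -/
theorem LocalGapSystem.exists_pinned_interval [Nontrivial E] {C₁ C₂ : Set E} {τ₁ τ₂ δ₁ δ₂ : ℝ}
    {G U : ℕ → Set E} (hG : LocalGapSystem C₁ τ₁ δ₁ G) (hU : LocalGapSystem C₂ τ₂ δ₂ U)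
    (hτ₂ : 0 < τ₂) (hτ : 1 < τ₁ * τ₂) (x : WithLp 2 (E × E)) :
    ∃ p : WithLp 2 (E × E), p.fst ∈ closure (G 0) ∧ ∀ ε > 0, ∃ ρ > 0, ∃ a b : ℝ, a < b ∧
      ∀ y, dist y x < ρ → ∀ t, a < t → t < b →
        ∃ z : WithLp 2 (E × E), (z.fst ∈ C₁ ∧ z.snd ∈ C₂) ∧ dist z p < ε ∧ dist y z = t := by
  obtain ⟨e, R, he, hR, hRc, hG', hGR, hRG, hA⟩ := hG.exists_line x.fst
  obtain ⟨f, Q, hf, hQ, -, hU', hUQ, hQU, hB⟩ := hU.exists_line x.snd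
  refine ⟨WithLp.toLp 2 (x.fst + R • e, x.snd + Q • f), hRc, fun ε hε => ?_⟩
  have hδ := half_pos (lt_min hG.pos hU.pos)
  obtain ⟨ρ, hρ, α, β, hα, hαβ, H⟩ := hG'.exists_sq_add_sq_eq (η := ε / 2)
    (A₁ := {r | x.fst + r • e ∈ C₁}) (A₂ := {r | x.snd + r • f ∈ C₂}) hU' hτ₂ hτ hR hQ hGR hUQ
    hRG hQU hδ (fun r hr => hA r (hr.trans_le (by gcongr; exact min_le_left _ _)))
    (fun r hr => hB r (hr.trans_le (by gcongr; exact min_le_right _ _))) (half_pos hε)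
  have hd : ∀ z w : WithLp 2 (E × E), dist z w ^ 2 = dist z.fst w.fst ^ 2 + dist z.snd w.snd ^ 2 :=
    fun z w => by rw [WithLp.prod_dist_eq_of_L2, Real.sq_sqrt (by positivity)]
  have hαβ' : 0 < (β - α) / 2 := by linarith
  -- The part of `y - x` orthogonal to the lines lowers the squared radius by less than `(β - α) /
  -- 2`, so `t ^ 2` between `(α + β) / 2` and `β` leaves it in `(α, β)`.
  refine ⟨min ρ √((β - α) / 2), lt_min hρ (Real.sqrt_pos.2 hαβ'), √((α + β) / 2), √β,
    Real.sqrt_lt_sqrt (by linarith) (by linarith), fun y hy t ht ht' => ?_⟩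
  rw [lt_min_iff, dist_comm, Real.lt_sqrt dist_nonneg, hd] at hy
  have ht0 : 0 < t := (Real.sqrt_nonneg _).trans_lt ht
  rw [Real.sqrt_lt' ht0] at ht
  rw [Real.lt_sqrt ht0.le] at ht'
  have h₁ := abs_inner_sub_le_dist (x := x.fst) (y := y.fst) he
  have h₂ := abs_inner_sub_le_dist (x := x.snd) (y := y.snd) hf
  have k₁ : dist x.fst y.fst < ρ := lt_of_le_of_lt (abs_le_of_sq_le_sq' (by
    rw [hd]; linarith [sq_nonneg (dist x.snd y.snd)]) dist_nonneg).2 hy.1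
  have k₂ : dist x.snd y.snd < ρ := lt_of_le_of_lt (abs_le_of_sq_le_sq' (by
    rw [hd]; linarith [sq_nonneg (dist x.fst y.fst)]) dist_nonneg).2 hy.1
  set s₁ := inner ℝ (x.fst - y.fst) e
  set s₂ := inner ℝ (x.snd - y.snd) f
  have l₁ : s₁ ^ 2 ≤ dist x.fst y.fst ^ 2 := by rw [← sq_abs s₁]; gcongr
  have l₂ : s₂ ^ 2 ≤ dist x.snd y.snd ^ 2 := by rw [← sq_abs s₂]; gcongr
  obtain ⟨r₁, hr₁, r₂, hr₂, n₁, n₂, hT⟩ := H s₁ s₂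
    (t ^ 2 - (dist x.fst y.fst ^ 2 - s₁ ^ 2) - (dist x.snd y.snd ^ 2 - s₂ ^ 2))
    (h₁.trans_lt k₁) (h₂.trans_lt k₂) (by linarith [sq_nonneg s₁, sq_nonneg s₂])
    (by linarith)
  refine ⟨WithLp.toLp 2 (x.fst + r₁ • e, x.snd + r₂ • f), ⟨hr₁, hr₂⟩, ?_, ?_⟩
  · refine lt_of_pow_lt_pow_left₀ 2 hε.le ?_
    rw [hd]
    change dist (x.fst + r₁ • e) (x.fst + R • e) ^ 2 + dist (x.snd + r₂ • f) (x.snd + Q • f) ^ 2 < _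
    rw [dist_add_smul_add_smul he, dist_add_smul_add_smul hf]
    have m₁ : |r₁ - R| ^ 2 < (ε / 2) ^ 2 := by gcongr
    have m₂ : |r₂ - Q| ^ 2 < (ε / 2) ^ 2 := by gcongr
    linarith [sq_nonneg ε]
  · refine (sq_eq_sq₀ dist_nonneg ht0.le).1 ?_
    rw [hd]
    change dist y.fst (x.fst + r₁ • e) ^ 2 + dist y.snd (x.snd + r₂ • f) ^ 2 = _
    rw [dist_add_smul_sq he, dist_add_smul_sq hf]
    linarith

end Line

/-! ### From thickness to local gap systems -/

theorem isOpen_of_mem_boundedGaps {d : ℕ} {C : Set (EuclideanSpace ℝ (Fin d))} (hC : IsClosed C)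
    {G : Set (EuclideanSpace ℝ (Fin d))} (hG : G ∈ boundedGaps C) : IsOpen G := by
  obtain ⟨x, -, rfl, -⟩ := hG
  exact hC.isOpen_compl.pathComponentIn x

theorem nonempty_of_mem_boundedGaps {d : ℕ} {C G : Set (EuclideanSpace ℝ (Fin d))}
    (hG : G ∈ boundedGaps C) : G.Nonempty := by
  obtain ⟨x, hx, rfl, -⟩ := hG
  exact ⟨x, mem_pathComponentIn_self hx⟩

theorem eq_of_mem_boundedGaps {d : ℕ} {C G G' : Set (EuclideanSpace ℝ (Fin d))}
    (hG : G ∈ boundedGaps C) (hG' : G' ∈ boundedGaps C) {u : EuclideanSpace ℝ (Fin d)}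
    (hu : u ∈ G) (hu' : u ∈ G') : G = G' := by
  obtain ⟨x, -, rfl, -⟩ := hG
  obtain ⟨y, -, rfl, -⟩ := hG'
  rw [← pathComponentIn_congr hu, ← pathComponentIn_congr hu']

theorem notMem_of_mem_boundedGaps {d : ℕ} {C G : Set (EuclideanSpace ℝ (Fin d))}
    (hG : G ∈ boundedGaps C) {u : EuclideanSpace ℝ (Fin d)} (hu : u ∈ G) : u ∉ C := by
  obtain ⟨x, -, rfl, -⟩ := hG
  exact pathComponentIn_subset hu

namespace GapEnumeration

variable {d : ℕ} {C : Set (EuclideanSpace ℝ (Fin d))} (e : GapEnumeration C)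

theorem mul_dist_le {τ : ℝ} (hτ : 0 ≤ τ) (h : ENNReal.ofReal τ < e.thickness)
    (n : {n : ℕ // (n : ℕ∞) < e.count}) {u v w z : EuclideanSpace ℝ (Fin d)}
    (hu : (∃ i < n, u ∈ (e.gap i : Set (EuclideanSpace ℝ (Fin d)))) ∨ u ∈ unboundedGap C)
    (hv : v ∈ (e.gap n : Set (EuclideanSpace ℝ (Fin d))))
    (hw : w ∈ (e.gap n : Set (EuclideanSpace ℝ (Fin d))))
    (hz : z ∈ (e.gap n : Set (EuclideanSpace ℝ (Fin d)))) : τ * dist v w ≤ dist z u := by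
  have h1 := ENNReal.mul_le_of_le_div (h.le.trans (iInf_le _ n))
  have h2 : ENNReal.ofReal τ * edist v w ≤ edist z u := by
    refine (mul_le_mul_right (Metric.edist_le_ediam_of_mem hv hw) _).trans (h1.trans ?_)
    refine iInf₂_le_of_le z hz (iInf₂_le_of_le u ?_ le_rfl)
    rcases hu with ⟨i, hi, hu⟩ | hu
    exacts [.inl (Set.mem_iUnion₂.2 ⟨i, hi, hu⟩), .inr hu]
  rwa [edist_dist, edist_dist, ← ENNReal.ofReal_mul hτ, ENNReal.ofReal_le_ofReal_iff dist_nonneg]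
    at h2

/-- The sequence of the gaps from number `m` on, continued by the empty set. -/
def tail (m n : ℕ) : Set (EuclideanSpace ℝ (Fin d)) :=
  {u | ∃ h : ((m + n : ℕ) : ℕ∞) < e.count, u ∈ (e.gap ⟨m + n, h⟩ : Set _)}

theorem gapSystem_tail (hC : IsClosed C) {τ : ℝ} (hτ : 0 ≤ τ)
    (h : ENNReal.ofReal τ < e.thickness) (m : ℕ) : GapSystem τ (e.tail m) := by
  refine ⟨fun n => ?_, fun i j u => ?_, fun i j hij u => ?_⟩
  · by_cases hn : ((m + n : ℕ) : ℕ∞) < e.count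
    · have : e.tail m n = e.gap ⟨m + n, hn⟩ := by
        ext u; exact ⟨fun ⟨_, hu⟩ => hu, fun hu => ⟨hn, hu⟩⟩
      rw [this]
      exact isOpen_of_mem_boundedGaps hC (e.gap _).2
    · have : e.tail m n = ∅ := Set.eq_empty_of_forall_notMem fun u ⟨h, _⟩ => hn h
      rw [this]
      exact isOpen_empty
  · rintro ⟨hi, hui⟩ ⟨hj, huj⟩
    have := e.gap.injective (Subtype.ext (eq_of_mem_boundedGaps (e.gap _).2 (e.gap _).2 hui huj))
    simpa using this
  · rintro ⟨hi, hu⟩ v ⟨hj, hv⟩ w ⟨_, hw⟩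
    exact e.mul_dist_le hτ h _ (.inl ⟨⟨m + i, hi⟩, by simpa using hij, hu⟩) hv hw hv

/-- For distinct `v`, `w` in gap `m`, earlier gaps and the unbounded one are at distance at least `τ
* dist v w` from it. Closer points lie in `C` or in a gap from number `m` on. -/
theorem exists_localGapSystem_tail [Nontrivial (EuclideanSpace ℝ (Fin d))] (hC : IsClosed C)
    {τ : ℝ} (hτ : 0 < τ) (h : ENNReal.ofReal τ < e.thickness) (m : ℕ)
    (hm : (m : ℕ∞) < e.count) : ∃ δ, LocalGapSystem C τ δ (e.tail m) := by
  have h0 : e.tail m 0 = e.gap ⟨m, hm⟩ := by ext u; simp [tail, hm]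
  have hne := nonempty_of_mem_boundedGaps (e.gap ⟨m, hm⟩).2
  obtain ⟨v, hv⟩ := hne
  obtain ⟨w, hw, hvw⟩ : ∃ w ∈ (e.gap ⟨m, hm⟩ : Set (EuclideanSpace ℝ (Fin d))), w ≠ v := by
    by_contra! hcon
    have hs := Set.eq_singleton_iff_unique_mem.2 ⟨hv, hcon⟩
    exact not_isOpen_singleton v (hs ▸ isOpen_of_mem_boundedGaps hC (e.gap ⟨m, hm⟩).2)
  have hpos : 0 < τ * dist v w := mul_pos hτ (dist_pos.2 hvw.symm)
  refine ⟨τ * dist v w, e.gapSystem_tail hC hτ.le h m, hpos, h0 ▸ ⟨v, hv⟩, ?_, fun u g hg hug => ?_⟩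
  · rw [h0]
    obtain ⟨x, -, -, hb⟩ := (e.gap ⟨m, hm⟩).2
    exact hb
  by_contra! hu
  rw [h0] at hg
  have key : ¬ ((∃ i < (⟨m, hm⟩ : {n : ℕ // (n : ℕ∞) < e.count}),
      u ∈ (e.gap i : Set (EuclideanSpace ℝ (Fin d)))) ∨ u ∈ unboundedGap C) := by
    intro hcon
    have h1 := e.mul_dist_le hτ.le h ⟨m, hm⟩ hcon hv hw hg
    rw [dist_comm g] at h1
    exact absurd hug h1.not_gt
  rw [not_or] at key
  by_cases hb : Bornology.IsBounded (pathComponentIn Cᶜ u)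
  · obtain ⟨i, hi⟩ := e.gap.surjective ⟨_, ⟨u, hu.1, rfl, hb⟩⟩
    have hui : u ∈ (e.gap i : Set (EuclideanSpace ℝ (Fin d))) := by
      rw [hi]; exact mem_pathComponentIn_self hu.1
    have hmi : m ≤ i := by
      by_contra! hlt
      exact key.1 ⟨i, hlt, hui⟩
    obtain ⟨n, hn⟩ := Nat.exists_eq_add_of_le hmi
    refine hu.2 n ⟨hn ▸ i.2, ?_⟩
    convert hui
    exact hn.symm
  · exact key.2 ⟨hu.1, hb⟩

/-- Distinct gaps have disjoint closures, since earlier gaps keep a positive distance. By pigeonhole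
the finite set cannot meet the closures of all of them. -/
theorem exists_localGapSystem_of_infinite [Nontrivial (EuclideanSpace ℝ (Fin d))]
    (hC : IsClosed C) {τ : ℝ} (hτ : 0 < τ) (h : ENNReal.ofReal τ < e.thickness)
    (hc : e.count = ⊤) {F : Set (EuclideanSpace ℝ (Fin d))} (hF : F.Finite) :
    ∃ δ G, LocalGapSystem C τ δ G ∧ Disjoint (closure (G 0)) F := by
  have hm : ∀ m : ℕ, (m : ℕ∞) < e.count := fun m => hc ▸ ENat.natCast_lt_top m
  choose δ hδ using fun m => e.exists_localGapSystem_tail hC hτ h m (hm m)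
  by_contra! hcon
  have hcon' : ∀ m, ∃ x : F, x.1 ∈ closure (e.tail m 0) := fun m => by
    obtain ⟨x, hx, hxF⟩ := Set.not_disjoint_iff.1 (hcon (δ m) _ (hδ m))
    exact ⟨⟨x, hxF⟩, hx⟩
  choose f hf using hcon'
  have := hF.to_subtype
  obtain ⟨i, j, hij, hfij⟩ := Finite.exists_ne_map_eq_of_infinite f
  wlog hlt : i < j generalizing i j
  · exact this j i hij.symm hfij.symm (lt_of_le_of_ne (not_lt.1 hlt) hij.symm)
  obtain ⟨u, hu, hu'⟩ := Metric.mem_closure_iff.1 (hf i) (δ j / 2) (half_pos (hδ j).pos)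
  obtain ⟨v, hv, hv'⟩ := Metric.mem_closure_iff.1 (hf j) (δ j / 2) (half_pos (hδ j).pos)
  rcases (hδ j).mem_or_mem u v hv (by rw [hfij] at hu'; linarith [dist_triangle_left u v (f j).1])
    with huC | ⟨n, hn, hun⟩
  · obtain ⟨_, hu⟩ := hu
    exact notMem_of_mem_boundedGaps (e.gap _).2 hu huC
  · obtain ⟨_, hu⟩ := hu
    have := e.gap.injective (Subtype.ext (eq_of_mem_boundedGaps (e.gap _).2 (e.gap _).2 hu hun))
    simp only [add_zero, Subtype.mk.injEq] at this
    omega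

/-- Around the last gap there is only `C`. If that collar were empty, the closure of the gap would
be clopen, hence the whole space, yet it is bounded. -/
theorem nonempty_interior_of_finite [Nontrivial (EuclideanSpace ℝ (Fin d))]
    (hC : IsClosed C) {τ : ℝ} (hτ : 0 < τ) (h : ENNReal.ofReal τ < e.thickness)
    (hgaps : (boundedGaps C).Nonempty) (hc : e.count ≠ ⊤) : (interior C).Nonempty := by
  obtain ⟨N, hN⟩ := ENat.ne_top_iff_exists.1 hc
  obtain ⟨m, hm⟩ : ∃ m, N = m + 1 := by
    obtain ⟨G, hG⟩ := hgaps
    obtain ⟨⟨n, hn⟩, -⟩ := e.gap.surjective ⟨G, hG⟩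
    rw [← hN] at hn
    exact Nat.exists_eq_add_one.2 ((Nat.zero_le n).trans_lt (by exact_mod_cast hn))
  obtain ⟨δ, hδ⟩ := e.exists_localGapSystem_tail hC hτ h m (by
    rw [← hN, hm]; exact_mod_cast m.lt_succ_self)
  have hsub : Metric.thickening δ (e.tail m 0) \ closure (e.tail m 0) ⊆ C := by
    rintro u ⟨hu, hu'⟩
    obtain ⟨g, hg, hug⟩ := Metric.mem_thickening_iff.1 hu
    refine (hδ.mem_or_mem u g hg hug).resolve_right ?_
    rintro ⟨n, hn⟩
    obtain ⟨hn', -⟩ := id hn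
    rw [← hN, hm] at hn'
    have : m + n < m + 1 := by exact_mod_cast hn'
    obtain rfl : n = 0 := by omega
    exact hu' (subset_closure hn)
  by_contra hint
  rw [Set.not_nonempty_iff_eq_empty] at hint
  have hemp := Set.subset_eq_empty
    (interior_maximal hsub (Metric.isOpen_thickening.sdiff isClosed_closure)) hint
  have heq : closure (e.tail m 0) = Metric.thickening δ (e.tail m 0) :=
    (Metric.closure_subset_thickening hδ.pos _).antisymm (Set.sdiff_eq_empty.1 hemp)
  have huniv : closure (e.tail m 0) = Set.univ :=
    IsClopen.eq_univ ⟨isClosed_closure, heq ▸ Metric.isOpen_thickening⟩ hδ.nonempty.closure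
  have hb := hδ.isBounded.closure
  rw [huniv] at hb
  exact NormedSpace.unbounded_univ ℝ (EuclideanSpace ℝ (Fin d)) hb

end GapEnumeration

/-- A small ball inside `C` serves as an artificial first gap. All later gaps are empty, so any `τ`
is allowed. -/
theorem exists_localGapSystem_of_nonempty_interior {X : Type*} [MetricSpace X]
    [∀ x : X, (nhdsWithin x {x}ᶜ).NeBot] {C : Set X} (hC : (interior C).Nonempty) (τ : ℝ)
    {F : Set X} (hF : F.Finite) : ∃ δ G, LocalGapSystem C τ δ G ∧ Disjoint (closure (G 0)) F := by
  obtain ⟨c₀, hc₀⟩ := hC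
  obtain ⟨c, hc, hcF⟩ :=
    ((infinite_of_mem_nhds c₀ (isOpen_interior.mem_nhds hc₀)).sdiff hF).nonempty
  have hopen : IsOpen (interior C \ F) := isOpen_interior.sdiff hF.isClosed
  obtain ⟨s, hs, hsub⟩ := Metric.isOpen_iff.1 hopen c ⟨hc, hcF⟩
  refine ⟨s / 2, fun n => if n = 0 then Metric.ball c (s / 2) else ∅,
    ⟨⟨fun n => ?_, fun m n u => ?_, fun m n hmn u _ v hv => ?_⟩, half_pos hs, ?_, ?_,
      fun u g hg hug => .inl ?_⟩, ?_⟩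
  · split_ifs
    exacts [Metric.isOpen_ball, isOpen_empty]
  · split_ifs <;> simp_all
  · simp [(Nat.zero_le m).trans_lt hmn |>.ne'] at hv
  · simpa using hs
  · simpa using Metric.isBounded_ball
  · simp only [if_true, Metric.mem_ball] at hg
    exact interior_subset (hsub (Metric.mem_ball.2 (by linarith [dist_triangle u g c]))).1
  · simp only [if_true]
    refine Set.disjoint_left.2 fun u hu huF => ?_
    have := Metric.closure_ball_subset_closedBall hu
    rw [Metric.mem_closedBall] at this
    exact (hsub (Metric.mem_ball.2 (by linarith))).2 huF

/-- A compact set of thickness greater than `τ` has a local gap system with separation constant `τ`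
whose first gap avoids a given finite set. -/
theorem exists_localGapSystem_of_lt_thickness {d : ℕ} [Nontrivial (EuclideanSpace ℝ (Fin d))]
    {C : Set (EuclideanSpace ℝ (Fin d))} (hC : IsClosed C) {τ : ℝ} (hτ : 0 < τ)
    (h : ENNReal.ofReal τ < thickness C) {F : Set (EuclideanSpace ℝ (Fin d))} (hF : F.Finite) :
    ∃ δ G, LocalGapSystem C τ δ G ∧ Disjoint (closure (G 0)) F := by
  unfold thickness at h
  split_ifs at h with h1 h2
  · obtain ⟨e, he⟩ := lt_iSup_iff.1 h
    by_cases hc : e.count = ⊤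
    · exact e.exists_localGapSystem_of_infinite hC hτ he hc hF
    · exact exists_localGapSystem_of_nonempty_interior
        (e.nonempty_interior_of_finite hC hτ he h1 hc) τ hF
  · exact exists_localGapSystem_of_nonempty_interior h2 τ hF
  · simp at h

/-! ### Building trees leaf by leaf -/

/-- If the distances from all pins close to a point to points of `B` close to a suitable point fill
an interval, and this can be achieved off any finite set, then so do the edge lengths of trees in
`B` with one vertex at a given point `x`. -/
theorem exists_edgeLength_box_of_isTree {X : Type*} [MetricSpace X] {B : Set X} {x : X}
    (hx : x ∈ B)
    (hB : ∀ y : X, ∀ F : Set X, F.Finite → ∃ p ∉ F, ∀ ε > 0, ∃ ρ > 0, ∃ a b : ℝ, a < b ∧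
      ∀ y', dist y' y < ρ → ∀ t, a < t → t < b → ∃ z ∈ B, dist z p < ε ∧ dist y' z = t)
    (n : ℕ) : ∀ {V : Type} [Fintype V] {T : SimpleGraph V}, T.IsTree → Fintype.card V = n + 1 →
    ∃ p : V → X, Function.Injective p ∧ ∀ ε > 0, ∃ a b : Sym2 V → ℝ, (∀ e, a e < b e) ∧
      ∀ l : Sym2 V → ℝ, (∀ e, a e < l e ∧ l e < b e) → ∃ q : V → X, (∀ i, q i ∈ B) ∧
        (∃ i, q i = x) ∧ (∀ i, dist (q i) (p i) < ε) ∧ ∀ e ∈ T.edgeSet, edgeLength q e = l e := by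
  classical
  induction n with
  | zero =>
    intro V _ T hT hV
    rw [zero_add, Fintype.card_eq_one_iff] at hV
    obtain ⟨v, hv⟩ := hV
    refine ⟨fun _ => x, fun i j _ => (hv i).trans (hv j).symm, fun ε hε => ⟨0, 1, by simp,
      fun l hl => ⟨fun _ => x, fun _ => hx, ⟨v, rfl⟩, fun _ => by simpa using hε, fun e => ?_⟩⟩⟩
    induction e with | _ i j
    intro hij
    rw [SimpleGraph.mem_edgeSet, hv i, hv j] at hij
    exact absurd hij T.irrefl
  | succ n ih =>
    intro V _ T hT hV
    have : Nontrivial V := Fintype.one_lt_card_iff_nontrivial.1 (by omega)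
    obtain ⟨v, hv⟩ := hT.exists_vert_degree_one_of_nontrivial
    have hT' : (T.induce {v}ᶜ).IsTree :=
      ⟨hT.connected.induce_compl_singleton_of_degree_eq_one hv, hT.isAcyclic.induce _⟩
    obtain ⟨w, hvw, hw⟩ := SimpleGraph.degree_eq_one_iff_existsUnique_adj.1 hv
    have hwv : w ∈ ({v}ᶜ : Set V) := hvw.ne'
    obtain ⟨p, hp, H⟩ := ih hT' (by
      rw [Fintype.card_compl_set, hV, Fintype.card_unique, Nat.add_sub_cancel])
    obtain ⟨p₀, hp₀, H₀⟩ := hB (p ⟨w, hwv⟩) (Set.range p) (Set.finite_range p)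
    let ext (f : ({v}ᶜ : Set V) → X) (z : X) (i : V) : X := if h : i = v then z else f ⟨i, h⟩
    have ext_v : ∀ f z, ext f z v = z := fun f z => by simp [ext]
    have ext_ne : ∀ f z i (h : i ≠ v), ext f z i = f ⟨i, h⟩ := fun f z i h => by simp [ext, h]
    refine ⟨ext p p₀, ?_, fun ε hε => ?_⟩
    · intro i j hij
      by_cases hi : i = v <;> by_cases hj : j = v
      · rw [hi, hj]
      · rw [hi, ext_v, ext_ne _ _ _ hj] at hij
        exact absurd ⟨_, hij.symm⟩ hp₀
      · rw [hj, ext_v, ext_ne _ _ _ hi] at hij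
        exact absurd ⟨_, hij⟩ hp₀
      · rw [ext_ne _ _ _ hi, ext_ne _ _ _ hj] at hij
        exact congrArg Subtype.val (hp hij)
    -- The reference points do not depend on `ε`, so the tolerance `ρ` for the leaf's neighbour can
    -- be fixed first and then imposed on the rest of the tree.
    obtain ⟨ρ, hρ, a₀, b₀, hab₀, K₀⟩ := H₀ ε hε
    obtain ⟨a, b, hab, K⟩ := H (min ε ρ) (lt_min hε hρ)
    let ι : Sym2 ({v}ᶜ : Set V) → Sym2 V := Sym2.map Subtype.val
    have hι : Function.Injective ι := Sym2.map.injective Subtype.val_injective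
    -- Among the pairs containing `v`, only `s(v, w)` is an edge; the default value matters only
    -- there.
    refine ⟨Function.extend ι a fun _ => a₀, Function.extend ι b fun _ => b₀, fun e => ?_,
      fun l hl => ?_⟩
    · by_cases he : ∃ e', ι e' = e
      · obtain ⟨e', rfl⟩ := he
        rw [hι.extend_apply, hι.extend_apply]
        exact hab e'
      · rwa [Function.extend_apply' _ _ _ he, Function.extend_apply' _ _ _ he]
    obtain ⟨q, hqB, ⟨i₀, hi₀⟩, hqp, hql⟩ := K (l ∘ ι) fun e => by
      simpa only [hι.extend_apply, Function.comp_apply] using hl (ι e)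
    have hlvw := hl s(v, w)
    have hnot : ¬ ∃ e', ι e' = s(v, w) := by
      rintro ⟨e', he'⟩
      have hmem : v ∈ ι e' := by rw [he']; exact Sym2.mem_mk_left v w
      obtain ⟨u, -, hu⟩ := Sym2.mem_map.1 hmem
      exact u.2 hu
    rw [Function.extend_apply' _ _ _ hnot, Function.extend_apply' _ _ _ hnot] at hlvw
    obtain ⟨z, hzB, hzp, hzl⟩ := K₀ (q ⟨w, hwv⟩) ((hqp _).trans_le (min_le_right _ _)) _
      hlvw.1 hlvw.2
    have hvl : ∀ j, T.Adj v j → dist (ext q z v) (ext q z j) = l s(v, j) := by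
      intro j hj
      rw [hw j hj, ext_v, ext_ne _ _ _ hvw.ne', dist_comm]
      exact hzl
    refine ⟨ext q z, fun i => ?_, ⟨i₀, ?_⟩, fun i => ?_, fun e => ?_⟩
    · by_cases hi : i = v
      · rwa [hi, ext_v]
      · rw [ext_ne _ _ _ hi]; exact hqB _
    · rw [ext_ne _ _ _ i₀.2]; exact hi₀
    · by_cases hi : i = v
      · rwa [hi, ext_v, ext_v]
      · rw [ext_ne _ _ _ hi, ext_ne _ _ _ hi]
        exact (hqp _).trans_le (min_le_left _ _)
    · induction e with | _ i j
      intro hij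
      change dist (ext q z i) (ext q z j) = _
      rw [SimpleGraph.mem_edgeSet] at hij
      by_cases hi : i = v
      · subst hi; exact hvl j hij
      by_cases hj : j = v
      · subst hj
        rw [dist_comm, Sym2.eq_swap]
        exact hvl i hij.symm
      rw [ext_ne _ _ _ hi, ext_ne _ _ _ hj]
      exact hql s(⟨i, hi⟩, ⟨j, hj⟩) hij

theorem interior_pinnedDistanceSet_nonempty {X : Type*} [MetricSpace X] {B : Set X} {x : X}
    {V : Type} [Finite V] {T : SimpleGraph V} {p : V → X} (hp : Function.Injective p)
    (H : ∀ ε > 0, ∃ a b : Sym2 V → ℝ, (∀ e, a e < b e) ∧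
      ∀ l : Sym2 V → ℝ, (∀ e, a e < l e ∧ l e < b e) → ∃ q : V → X, (∀ i, q i ∈ B) ∧
        (∃ i, q i = x) ∧ (∀ i, dist (q i) (p i) < ε) ∧ ∀ e ∈ T.edgeSet, edgeLength q e = l e) :
    (interior (pinnedDistanceSet T x B)).Nonempty := by
  classical
  -- Placements within `ε` of the distinct points `p i` are then injective.
  obtain ⟨ε, hε', hε⟩ : ∃ ε : ℝ, (∀ i j, i ≠ j → 2 * ε < dist (p i) (p j)) ∧ 0 < ε := by
    have h : ∀ᶠ ε : ℝ in nhds 0, ∀ i j, i ≠ j → 2 * ε < dist (p i) (p j) := by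
      refine Filter.eventually_all.2 fun i => Filter.eventually_all.2 fun j => ?_
      by_cases hij : i = j
      · exact Filter.Eventually.of_forall fun _ h => absurd hij h
      · refine (Filter.Tendsto.eventually_lt_const (dist_pos.2 (hp.ne hij))
          (Continuous.tendsto' (by fun_prop) 0 0 (by simp))).mono fun ε h _ => h
    exact ((h.filter_mono nhdsWithin_le_nhds).and
      (self_mem_nhdsWithin : Set.Ioi (0 : ℝ) ∈ nhdsWithin 0 (Set.Ioi 0))).exists
  obtain ⟨a, b, hab, K⟩ := H ε hε
  refine ⟨fun e => (a e + b e) / 2, mem_interior.2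
    ⟨Set.univ.pi fun e => Set.Ioo (a e) (b e), fun l hl => ?_,
      isOpen_set_pi Set.finite_univ fun _ _ => isOpen_Ioo, fun e _ => ?_⟩⟩
  · obtain ⟨q, hqB, hqx, hqp, hql⟩ :=
      -- The box is indexed by all pairs; midpoints fill the coordinates that are not edges.
      K (fun e => if h : e ∈ T.edgeSet then l ⟨e, h⟩ else (a e + b e) / 2) fun e => by
        split_ifs with h
        · exact hl ⟨e, h⟩ trivial
        · constructor <;> linarith [hab e]
    refine ⟨q, hqB, fun i j hij => ?_, hqx, funext fun e => ?_⟩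
    · by_contra hne
      have h1 := hqp i
      have h2 := hqp j
      rw [← hij] at h2
      linarith [hε' i j hne, dist_triangle_left (p i) (p j) (q i)]
    · rw [hql e e.2, dif_pos e.2]
  · constructor <;> linarith [hab e]

/-- Strictly smaller factors are finite, so infinite thickness needs no separate treatment. -/
theorem ENNReal.exists_ofReal_lt_ofReal_lt_of_one_lt_mul {a b : ℝ≥0∞} (h : 1 < a * b) :
    ∃ s t : ℝ, 0 < s ∧ 0 < t ∧ 1 < s * t ∧ ENNReal.ofReal s < a ∧ ENNReal.ofReal t < b := by
  obtain ⟨a', ha, b', hb, hab⟩ : ∃ a' < a, ∃ b' < b, 1 < a' * b' := by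
    by_contra! hcon
    exact h.not_ge (ENNReal.mul_le_of_forall_lt hcon)
  lift a' to NNReal using ha.ne_top
  lift b' to NNReal using hb.ne_top
  have hab' : (1 : ℝ) < a' * b' := by exact_mod_cast hab
  have hpos := zero_lt_one.trans hab'
  refine ⟨a', b', pos_of_mul_pos_left hpos b'.2, pos_of_mul_pos_right hpos a'.2, hab',
    ?_, ?_⟩
  · simpa using ha
  · simpa using hb

theorem mainTheorem1 {d : ℕ} (hd : 1 ≤ d) (C₁ C₂ : Set (EuclideanSpace ℝ (Fin d)))
    (hC₁ : IsCompact C₁) (hC₂ : IsCompact C₂) (hτ : 1 < thickness C₁ * thickness C₂)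
    (x : WithLp 2 (EuclideanSpace ℝ (Fin d) × EuclideanSpace ℝ (Fin d)))
    (hx : x ∈ euclideanProd C₁ C₂)
    (k : ℕ) (T : SimpleGraph (Fin (k + 1))) (hT : T.IsTree) :
    (interior (pinnedDistanceSet T x (euclideanProd C₁ C₂))).Nonempty := by
  have : Nonempty (Fin d) := ⟨⟨0, hd⟩⟩
  obtain ⟨s, t, hs, ht, hst, hs₁, ht₂⟩ := ENNReal.exists_ofReal_lt_ofReal_lt_of_one_lt_mul hτ
  obtain ⟨p, hp, H⟩ := exists_edgeLength_box_of_isTree hx (fun y F hF => by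
    -- Avoiding the first projections of `F` suffices: the first component of `p` lies in `closure
    -- (G 0)`.
    obtain ⟨δ₁, G, hG, hGF⟩ := exists_localGapSystem_of_lt_thickness hC₁.isClosed hs hs₁
      (hF.image fun z => z.fst)
    obtain ⟨δ₂, U, hU, -⟩ := exists_localGapSystem_of_lt_thickness hC₂.isClosed ht ht₂
      Set.finite_empty
    obtain ⟨p, hp, H⟩ := hG.exists_pinned_interval hU ht hst y
    exact ⟨p, fun hpF => Set.disjoint_left.1 hGF hp ⟨p, hpF, rfl⟩, H⟩) k hT (Fintype.card_fin _)
  exact interior_pinnedDistanceSet_nonempty hp H
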